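/- Let $\mathbb{N}=\{1,2,3,\dots\}$, let $\alpha>0$ and $0<\gamma<1$, put $g_{\alpha,\gamma}(n)=\lfloor n\alpha+\gamma\rfloor$, and for $A\subseteq\mathbb{N}$ let $g_{\alpha,\gamma}[A]=\{g_{\alpha,\gamma}(n):n\in A\}\cap\mathbb{N}$ (the value $0$, which can occur for finitely many $n$ only, is discarded). The points of $\beta\mathbb{N}$ are the ultrafilters on $\mathbb{N}$, with the operation $A\in p+q\iff\{x:\{y:x+y\in A\}\in q\}\in p$ and the usual topology. For a collection $\mathcal{F}$ of subsets of $\mathbb{N}$ let $\beta(\mathcal{F})=\{p\in\beta\mathbb{N}:p\subseteq\mathcal{F}\}$. A set $A\subseteq\mathbb{N}$ is an essential $\mathcal{F}$-set if $A\in p$ for some idempotent $p=p+p\in\beta(\mathcal{F})$. For a class $\mathcal{P}$ of subsets of $\mathbb{N}$, a set $A\subseteq\mathbb{N}$ is a $\mathcal{P}^{\star}$-set if $A\cap B\neq\emptyset$ for every $B\in\mathcal{P}$; in particular $A$ is an essential $\mathcal{F}^{\star}$-set if it meets every essential $\mathcal{F}$-set. Consider the following seven families of sets $A\subseteq\mathbb{N}$: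 - $\mathcal{IF}$: $A$ is infinite; - $\mathcal{AP}$: $A$ contains arithmetic progressions of every finite length (with positive common difference); - $\mathcal{PS}$ (piecewise syndetic): there is a finite nonempty $G\subseteq\mathbb{N}$ such that for every finite nonempty $F\subseteq\mathbb{N}$ there is $x\in\mathbb{N}$ with $F+x\subseteq\bigcup_{t\in G}(-t+A)$, where $-t+A=\{s\in\mathbb{N}:t+s\in A\}$; - $\mathcal{HSD}$: $\sum_{n\in A}1/n=\infty$; - $\mathcal{J}$: for every finite nonempty set $F$ of sequences in $\mathbb{N}$ there are $a\in\mathbb{N}$ and a finite nonempty set $H$ of indices such that $a+\sum_{n\in H}f(n)\in A$ for all $f\in F$; - $\mathcal{PUAD}$: $\limsup_{n\to\infty}|A\cap\{1,\dots,n\}|/n>0$; - $\mathcal{PUBD}$: $\limsup_{n-m\to\infty}|A\cap\{m+1,\dots,n\}|/(n-m)>0$. Let $\mathcal{F}$ be any one of these seven families. Then for every $A\subseteq\mathbb{N}$: if $A$ is an essential $\mathcal{F}$-set, so is $g_{\alpha,\gamma}[A]$; and if $A$ is an essential $\mathcal{F}^{\star}$-set, so is $g_{\alpha,\gamma}[A]$.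 In particular, if $A$ is an $IP$-set, a $C$-set, a $D$-set or a quasi-central set, then $g_{\alpha,\gamma}[A]$ is a set of the same kind, and likewise for $IP^{\star}$-, $C^{\star}$-, $D^{\star}$- and quasi-central$^{\star}$ sets. Here an $IP$-set is a set containing all sums $\sum_{n\in H}x_n$, $H$ finite and nonempty, of some sequence $(x_n)$ in $\mathbb{N}$; a $C$-set is a member of an idempotent of $\beta\mathbb{N}$ all of whose members are in $\mathcal{J}$; a $D$-set is a member of an idempotent all of whose members are in $\mathcal{PUBD}$; and a quasi-central set is a member of an idempotent in the closure of the smallest two-sided ideal $K(\beta\mathbb{N})$, the union of all minimal left ideals of $\beta\mathbb{N}$. -/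

import Mathlib

open Filter

namespace EssentialSpectra

/-! Throughout, the semigroup of positive integers under addition is `ℕ+`, and its
Stone-Čech compactification is the space `Ultrafilter ℕ+`. -/

section Algebra

/- The extended addition: `A ∈ p + q ↔ {x | {y | x + y ∈ A} ∈ q} ∈ p`. -/
attribute [local instance] Ultrafilter.add

/-- `p + p = p` in the Stone-Čech compactification of the positive integers. -/
def IsIdem (p : Ultrafilter ℕ+) : Prop := p + p = p

/-- A left ideal: a nonempty set `I` with `q + p ∈ I` for all `q` and all `p ∈ I`. -/
def IsLeftIdeal (I : Set (Ultrafilter ℕ+)) : Prop :=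
  I.Nonempty ∧ ∀ q : Ultrafilter ℕ+, ∀ p ∈ I, q + p ∈ I

end Algebra

/-- A left ideal that contains no proper left ideal. -/
def IsMinimalLeftIdeal (L : Set (Ultrafilter ℕ+)) : Prop :=
  IsLeftIdeal L ∧ ∀ I : Set (Ultrafilter ℕ+), IsLeftIdeal I → I ⊆ L → I = L

/-- The smallest two sided ideal, as the union of all minimal left ideals. -/
def smallestIdeal : Set (Ultrafilter ℕ+) := ⋃₀ {L | IsMinimalLeftIdeal L}

/-- The ultrafilters all of whose members belong to the collection `F`. -/
def beta (F : Set (Set ℕ+)) : Set (Ultrafilter ℕ+) := {p | ∀ A ∈ p, A ∈ F}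

/-- `A` is a member of some idempotent of `beta F`. -/
def IsEssential (F : Set (Set ℕ+)) (A : Set ℕ+) : Prop :=
  ∃ p ∈ beta F, IsIdem p ∧ A ∈ p

/-- `A` meets every set of the class `P`. -/
def IsStar (P : Set ℕ+ → Prop) (A : Set ℕ+) : Prop :=
  ∀ B : Set ℕ+, P B → (A ∩ B).Nonempty

/-! ### The seven families -/

/-- Infinite sets. -/
def familyIF : Set (Set ℕ+) := {A | A.Infinite}

/-- Sets containing arithmetic progressions of every finite length. -/
def familyAP : Set (Set ℕ+) :=
  {A | ∀ k : ℕ, ∃ a d : ℕ+, ∀ i < k, ∃ m ∈ A, (m : ℕ) = a + i * d}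

/-- Piecewise syndetic sets. -/
def familyPS : Set (Set ℕ+) :=
  {A | ∃ G : Finset ℕ+, G.Nonempty ∧ ∀ F : Finset ℕ+, F.Nonempty →
    ∃ x : ℕ+, ∀ s ∈ F, ∃ t ∈ G, t + (s + x) ∈ A}

/-- Sets with divergent sum of reciprocals. -/
def familyHSD : Set (Set ℕ+) := {A | ¬ Summable fun n : A ↦ (1 : ℝ) / ((n : ℕ+) : ℕ)}

/-- `J`-sets. -/
def familyJ : Set (Set ℕ+) :=
  {A | ∀ F : Finset (ℕ → ℕ+), F.Nonempty → ∃ a : ℕ+, ∃ H : Finset ℕ, H.Nonempty ∧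
    ∀ f ∈ F, ∃ m ∈ A, (m : ℕ) = a + ∑ n ∈ H, (f n : ℕ)}

/-- The number of elements of `A` among `m + 1, …, n`. -/
noncomputable def countIoc (A : Set ℕ+) (m n : ℕ) : ℕ :=
  {k : ℕ+ | k ∈ A ∧ m < (k : ℕ) ∧ (k : ℕ) ≤ n}.ncard

/-- Upper asymptotic density. -/
noncomputable def upperDensity (A : Set ℕ+) : ℝ :=
  limsup (fun n : ℕ ↦ (countIoc A 0 n : ℝ) / n) atTop

/-- Upper Banach density: the limit superior, as `n - m → ∞`, of the relative density of `A`
in `{m + 1, …, n}`. -/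
noncomputable def upperBanachDensity (A : Set ℕ+) : ℝ :=
  limsup (fun I : ℕ × ℕ ↦ (countIoc A I.1 I.2 : ℝ) / ((I.2 : ℝ) - I.1))
    (comap (fun I : ℕ × ℕ ↦ (I.2 : ℝ) - I.1) atTop)

/-- Sets of positive upper asymptotic density. -/
def familyPUAD : Set (Set ℕ+) := {A | 0 < upperDensity A}

/-- Sets of positive upper Banach density. -/
def familyPUBD : Set (Set ℕ+) := {A | 0 < upperBanachDensity A}

/-! ### The classical notions -/

/-- `A` contains all finite sums of distinct terms of some sequence. -/
def IsIPSet (A : Set ℕ+) : Prop := ∃ x : Stream' ℕ+, Hindman.FS x ⊆ A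

/-- `A` is a member of an idempotent in the closure of the smallest ideal. -/
def IsQuasiCentral (A : Set ℕ+) : Prop :=
  ∃ p ∈ closure smallestIdeal, IsIdem p ∧ A ∈ p

/-- `A` is a member of an idempotent all of whose members have positive upper Banach density. -/
def IsDSet (A : Set ℕ+) : Prop :=
  ∃ p : Ultrafilter ℕ+, IsIdem p ∧ (∀ B ∈ p, 0 < upperBanachDensity B) ∧ A ∈ p

/-- `A` is a member of an idempotent all of whose members are `J`-sets. -/
def IsCSet (A : Set ℕ+) : Prop :=
  ∃ p : Ultrafilter ℕ+, IsIdem p ∧ (∀ B ∈ p, B ∈ familyJ) ∧ A ∈ p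

/-! ### Nonhomogeneous spectra -/

/-- The map `n ↦ ⌊n α + γ⌋`. For small `n` the value may be `0`. -/
noncomputable def g (α γ : ℝ) (n : ℕ+) : ℤ := ⌊((n : ℕ) : ℝ) * α + γ⌋

/-- The image of `A` under `g α γ`, as a set of positive integers. -/
def gImage (α γ : ℝ) (A : Set ℕ+) : Set ℕ+ := {m | ∃ n ∈ A, g α γ n = ((m : ℕ) : ℤ)}

end EssentialSpectra

namespace EssentialSpectra

/-! ### Idempotents and maps that are additive on a large set -/

section Idempotents

attribute [local instance] Ultrafilter.add Ultrafilter.addSemigroup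

/-! Let `p` be idempotent. The homomorphism `n ↦ nα mod 1` into the compact circle converges along
`p` to an idempotent of a group, hence to `0`; so `near α ε ∈ p` for every `ε > 0`. For small `ε`,
`g α γ` agrees there with `nearest α`, whatever `γ` is, and `nearest α` is additive and injective
there. Hence `p.map (nearest α)` is idempotent and contains `gImage α γ A` whenever `A ∈ p`. It lies
in `beta F` once `F` is transferable, which is checked family by family; only `J` and `PS` need real
work.

A star set is one that belongs to every idempotent of `beta F` (`isStar_isEssential_iff`). Such an
idempotent `q` is pushed forward by `nearest α⁻¹`, and `g α γ` inverts that map on a member of `q`.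

The classical notions reduce to essential sets: IP-sets by Hindman's theorem, quasi-central sets by
`closure_smallestIdeal`. -/

theorem mem_add_iff {p q : Ultrafilter ℕ+} {A : Set ℕ+} :
    A ∈ p + q ↔ {x | {y | x + y ∈ A} ∈ q} ∈ p :=
  Ultrafilter.eventually_add p q (· ∈ A)

theorem IsIdem.mem_iff {p : Ultrafilter ℕ+} (hp : IsIdem p) {A : Set ℕ+} :
    {x | {y | x + y ∈ A} ∈ p} ∈ p ↔ A ∈ p := by
  rw [← mem_add_iff, hp]

/-- An ultrafilter image of an idempotent under a map additive on a large set is idempotent. -/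
theorem IsIdem.map {p : Ultrafilter ℕ+} (hp : IsIdem p) {S : Set ℕ+} (hS : S ∈ p) {f : ℕ+ → ℕ+}
    (hf : ∀ x ∈ S, ∀ y ∈ S, f (x + y) = f x + f y) : IsIdem (p.map f) := by
  have key : ∀ D : Set ℕ+, D ∈ p.map f → D ∈ p.map f + p.map f := by
    intro D hD
    rw [Ultrafilter.mem_map, ← hp.mem_iff] at hD
    rw [mem_add_iff, Ultrafilter.mem_map]
    filter_upwards [hD, hS] with x hx hxS
    change _ ∈ p at hx
    change {y | f x + y ∈ D} ∈ p.map f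
    rw [Ultrafilter.mem_map]
    filter_upwards [hx, hS] with y hy hyS
    change f (x + y) ∈ D at hy
    change f x + f y ∈ D
    rwa [← hf x hxS y hyS]
  -- Comparable ultrafilters are equal, so one inclusion suffices.
  exact Ultrafilter.coe_le_coe.1 key

theorem IsIdem.infinite {p : Ultrafilter ℕ+} (hp : IsIdem p) {A : Set ℕ+} (hA : A ∈ p) :
    A.Infinite := by
  intro hfin
  obtain ⟨a, -, rfl⟩ := Ultrafilter.eq_pure_of_finite_mem hfin hA
  have h : ({a} : Set ℕ+) ∈ (pure a : Ultrafilter ℕ+) := Ultrafilter.mem_pure.2 rfl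
  rw [← hp.mem_iff] at h
  have h' : a + a = a := h
  exact (PNat.lt_add_right a a).ne' h'

/-- A character of the semigroup converges to `0` along any idempotent. -/
theorem IsIdem.tendsto_zero {p : Ultrafilter ℕ+} (hp : IsIdem p) {T : Type*} [AddGroup T]
    [TopologicalSpace T] [ContinuousAdd T] [CompactSpace T] [T2Space T] {φ : ℕ+ → T}
    (hφ : ∀ x y, φ (x + y) = φ x + φ y) : Tendsto φ p (nhds 0) := by
  obtain ⟨u, -, hu⟩ := isCompact_univ.ultrafilter_le_nhds (p.map φ) (by simp)
  have hu : Tendsto φ p (nhds u) := hu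
  suffices h : u + u = u by rwa [add_eq_left.1 h] at hu
  by_contra hne
  obtain ⟨V, W, hV, hW, hVu, hWu, hVW⟩ := t2_separation hne
  have hadd : Tendsto (fun z : T × T ↦ z.1 + z.2) (nhds u ×ˢ nhds u) (nhds (u + u)) := by
    rw [← nhds_prod_eq]
    exact continuous_add.tendsto (u, u)
  obtain ⟨N, hN, N', hN', hNV⟩ := mem_prod_iff.1 (hadd (hV.mem_nhds hVu))
  have hWp : φ ⁻¹' W ∈ p := hu (hW.mem_nhds hWu)
  have hNp : φ ⁻¹' N ∈ p := hu hN
  have hNp' : φ ⁻¹' N' ∈ p := hu hN'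
  -- If `u + u ≠ u`, idempotence yields `x`, `y` with `φ x + φ y` near `u + u` and `φ (x + y)` near
  -- `u`.
  rw [← hp.mem_iff] at hWp
  obtain ⟨x, hx, hxN⟩ := p.nonempty_of_mem (inter_mem hWp hNp)
  obtain ⟨y, hy, hyN⟩ := p.nonempty_of_mem (inter_mem hx hNp')
  have h1 : φ x + φ y ∈ V := hNV (Set.mk_mem_prod hxN hyN)
  have h2 : φ (x + y) ∈ W := hy
  rw [hφ] at h2
  exact Set.disjoint_left.1 hVW h1 h2

end Idempotents

/-! ### Nearest integers of multiples of `α` -/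

/-- The integer nearest to `n * α`, as a positive integer. -/
noncomputable def nearest (α : ℝ) (n : ℕ+) : ℕ+ := (round ((n : ℕ) * α)).toNat.toPNat'

/-- The `n` for which `n * α` is within `ε` of `nearest α n`. -/
def near (α ε : ℝ) : Set ℕ+ := {n | |((n : ℕ) : ℝ) * α - (nearest α n : ℕ)| < ε}

theorem one_le_cast (n : ℕ+) : (1 : ℝ) ≤ (n : ℕ) := by exact_mod_cast n.pos

theorem le_cast_mul {α : ℝ} (hα : 0 < α) (n : ℕ+) : α ≤ (n : ℕ) * α :=
  le_mul_of_one_le_left hα.le (one_le_cast n)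

/-- Only the sum of the radii matters, so one of the two estimates may be coarse. -/
theorem int_eq_of_abs_lt {x ε : ℝ} {a b : ℤ} (ha : |x - a| < ε) (hb : |x - b| < 1 - ε) :
    a = b := by
  have h : |(a : ℝ) - b| < 1 := by
    rw [abs_lt] at *
    constructor <;> linarith
  have h' : |a - b| < 1 := by exact_mod_cast h
  rw [Int.abs_lt_one_iff] at h'
  omega

theorem pnat_eq_of_abs_lt {x ε : ℝ} {a b : ℕ+} (ha : |x - (a : ℕ)| < ε)
    (hb : |x - (b : ℕ)| < 1 - ε) : a = b := by
  have h : ((a : ℕ) : ℤ) = (b : ℕ) := int_eq_of_abs_lt (x := x) (by simpa using ha) (by simpa using hb)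
  exact_mod_cast h

/-- An integer close to a larger positive real is positive. -/
theorem exists_pnat_of_abs_lt {x ε : ℝ} {a : ℤ} (ha : |x - a| < ε) (hx : ε ≤ x) :
    ∃ b : ℕ+, a = (b : ℕ) := by
  have h : (0 : ℝ) < a := by
    rw [abs_lt] at ha
    linarith
  have h' : 0 < a := by exact_mod_cast h
  exact ⟨⟨a.toNat, by omega⟩, by simp [h'.le]⟩

/-- The bound `hn` makes the rounded value positive, so the default values of `toNat` and `toPNat'`
do not occur. -/
theorem nearest_cast {α ε : ℝ} {n : ℕ+} (h : |((n : ℕ) : ℝ) * α - round ((n : ℕ) * α)| < ε)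
    (hn : ε ≤ (n : ℕ) * α) : ((nearest α n : ℕ) : ℤ) = round ((n : ℕ) * α) := by
  obtain ⟨b, hb⟩ := exists_pnat_of_abs_lt h hn
  rw [nearest, hb]
  simp

theorem IsIdem.near_mem {p : Ultrafilter ℕ+} (hp : IsIdem p) {α ε : ℝ} (hα : 0 < α) (hε : 0 < ε) :
    near α ε ∈ p := by
  -- For `ε ≤ α` the bound required by `nearest_cast` holds for every `n`; larger `ε` follow by
  -- monotonicity.
  have key : ∀ ε : ℝ, 0 < ε → ε ≤ α → near α ε ∈ p := by
    intro ε hε hεα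
    have h := hp.tendsto_zero (φ := fun n ↦ ((((n : ℕ) : ℝ) * α : ℝ) : UnitAddCircle))
      (fun x y ↦ by push_cast; rw [add_mul]; exact QuotientAddGroup.mk_add _ _ _)
    have h0 := h (Metric.ball_mem_nhds 0 hε)
    change _ ∈ p at h0
    filter_upwards [h0] with n hn
    rw [Set.mem_preimage, mem_ball_zero_iff, UnitAddCircle.norm_eq] at hn
    have hc := nearest_cast hn (hεα.trans (le_cast_mul hα n))
    have hc' : ((nearest α n : ℕ) : ℝ) = round (((n : ℕ) : ℝ) * α) := by exact_mod_cast hc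
    rwa [near, Set.mem_ofPred_eq, hc']
  refine mem_of_superset (key (min ε α) (lt_min hε hα) (min_le_right _ _)) fun n hn ↦ ?_
  rw [near, Set.mem_ofPred_eq] at *
  exact hn.trans_le (min_le_left _ _)

theorem nearest_add {α ε : ℝ} (hε : ε ≤ 1 / 8) {x y : ℕ+}
    (hx : x ∈ near α ε) (hy : y ∈ near α ε) :
    nearest α (x + y) = nearest α x + nearest α y := by
  rw [near, Set.mem_ofPred_eq] at hx hy
  have hxy : |(((x + y : ℕ+) : ℕ) : ℝ) * α - ((nearest α x + nearest α y : ℕ+) : ℕ)| < 1 / 4 := by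
    push_cast
    rw [abs_lt] at *
    constructor <;> linarith
  have h : round ((((x + y : ℕ+) : ℕ) : ℝ) * α) = ((nearest α x + nearest α y : ℕ+) : ℕ) := by
    rw [round_eq, Int.floor_eq_iff]
    rw [abs_lt] at hxy
    push_cast at *
    constructor <;> linarith
  rw [nearest, h, Int.toNat_natCast, PNat.coe_toPNat']

/-- On `near α ε` the map `g α γ` takes nearest integers. -/
theorem g_eq_nearest {α γ ε : ℝ} (h₀ : ε ≤ γ) (h₁ : ε ≤ 1 - γ) {n : ℕ+} (hn : n ∈ near α ε) :
    g α γ n = (nearest α n : ℕ) := by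
  rw [near, Set.mem_ofPred_eq, abs_lt] at hn
  rw [g, Int.floor_eq_iff]
  push_cast
  constructor <;> linarith

/-- A common nearest integer forces `|x - y| * α < 2 * ε < α`. -/
theorem nearest_injOn {α ε : ℝ} (hα : 0 < α) (hε : ε ≤ α / 4) : Set.InjOn (nearest α) (near α ε) := by
  intro x hx y hy hxy
  rw [near, Set.mem_ofPred_eq] at hx hy
  rw [hxy] at hx
  have h : |((x : ℕ) : ℝ) - (y : ℕ)| * α < 1 * α := by
    rw [← abs_of_pos hα, ← abs_mul, abs_of_pos hα, sub_mul]
    rw [abs_lt] at *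
    constructor <;> linarith
  have h1 := lt_of_mul_lt_mul_right h hα.le
  have h2 : |((x : ℕ) : ℤ) - (y : ℕ)| < 1 := by exact_mod_cast h1
  rw [Int.abs_lt_one_iff] at h2
  have : (x : ℕ) = y := by omega
  exact_mod_cast this

/-- `F` is carried into itself by `nearest α` on sets of `n` with `n * α` close to an integer. -/
def IsTransferable (F : Set (Set ℕ+)) : Prop :=
  ∀ α ε : ℝ, 0 < α → 0 < ε → ε ≤ α / 4 → ε ≤ 1 / 8 → ∀ B ∈ F, B ⊆ near α ε →
    ∀ D : Set ℕ+, (∀ n ∈ B, nearest α n ∈ D) → D ∈ F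

theorem exists_small {α γ : ℝ} (hα : 0 < α) (hγ₀ : 0 < γ) (hγ₁ : γ < 1) :
    ∃ ε : ℝ, 0 < ε ∧ ε ≤ α / 4 ∧ ε ≤ 1 / 8 ∧ ε ≤ γ ∧ ε ≤ 1 - γ := by
  refine ⟨min (α / 4) (min (1 / 8) (min γ (1 - γ))), ?_, ?_, ?_, ?_, ?_⟩
  · have : 0 < 1 - γ := by linarith
    positivity
  all_goals simp

theorem IsIdem.map_nearest {p : Ultrafilter ℕ+} (hp : IsIdem p) {α : ℝ} (hα : 0 < α) :
    IsIdem (p.map (nearest α)) :=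
  hp.map (hp.near_mem hα (by norm_num : (0 : ℝ) < 1 / 8))
    fun _ hx _ hy ↦ nearest_add le_rfl hx hy

theorem IsTransferable.map_nearest {F : Set (Set ℕ+)} (hF : IsTransferable F) {α : ℝ} (hα : 0 < α)
    {p : Ultrafilter ℕ+} (hp : IsIdem p) (hpF : p ∈ beta F) : p.map (nearest α) ∈ beta F := by
  intro D hD
  obtain ⟨ε, h0, h1, h2, -⟩ := exists_small hα one_half_pos one_half_lt_one
  exact hF α ε hα h0 h1 h2 _ (hpF _ (inter_mem (Ultrafilter.mem_map.1 hD) (hp.near_mem hα h0)))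
    Set.inter_subset_right D fun n hn ↦ hn.1

theorem IsTransferable.isEssential_gImage {F : Set (Set ℕ+)} (hF : IsTransferable F) {α γ : ℝ}
    (hα : 0 < α) (hγ₀ : 0 < γ) (hγ₁ : γ < 1) {A : Set ℕ+} (hA : IsEssential F A) :
    IsEssential F (gImage α γ A) := by
  obtain ⟨p, hpF, hp, hAp⟩ := hA
  refine ⟨p.map (nearest α), hF.map_nearest hα hp hpF, hp.map_nearest hα, ?_⟩
  obtain ⟨ε, h0, -, -, h3, h4⟩ := exists_small hα hγ₀ hγ₁
  rw [Ultrafilter.mem_map]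
  filter_upwards [hAp, hp.near_mem hα h0] with n hn hnear
  exact ⟨n, hn, g_eq_nearest h3 h4 hnear⟩

/-- If `A` were not in `p`, then `Aᶜ` would be an essential set missing `A`. -/
theorem isStar_isEssential_iff {F : Set (Set ℕ+)} {A : Set ℕ+} :
    IsStar (IsEssential F) A ↔ ∀ p ∈ beta F, IsIdem p → A ∈ p := by
  constructor
  · intro h p hpF hp
    by_contra hA
    obtain ⟨x, hx, hx'⟩ := h Aᶜ ⟨p, hpF, hp, Ultrafilter.compl_mem_iff_notMem.2 hA⟩
    exact hx' hx
  · rintro h B ⟨p, hpF, hp, hB⟩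
    exact p.nonempty_of_mem (inter_mem (h p hpF hp) hB)

theorem IsTransferable.isStar_gImage {F : Set (Set ℕ+)} (hF : IsTransferable F) {α γ : ℝ}
    (hα : 0 < α) (hγ₀ : 0 < γ) (hγ₁ : γ < 1) {A : Set ℕ+} (hA : IsStar (IsEssential F) A) :
    IsStar (IsEssential F) (gImage α γ A) := by
  rw [isStar_isEssential_iff] at *
  intro q hqF hq
  have hα' : 0 < α⁻¹ := inv_pos.2 hα
  have hAq := hA _ (hF.map_nearest hα' hq hqF) (hq.map_nearest hα')
  obtain ⟨ε, h0, -, -, h3, h4⟩ := exists_small hα hγ₀ hγ₁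
  rw [Ultrafilter.mem_map] at hAq
  -- With `n = nearest α⁻¹ m`, an error below `ε / α` in `m * α⁻¹ ≈ n` becomes an error below `ε` in
  -- `n * α ≈ m`, whence `g α γ n = m`.
  filter_upwards [hAq, hq.near_mem hα' (div_pos h0 hα)] with m hm hnear
  refine ⟨_, hm, ?_⟩
  rw [near, Set.mem_ofPred_eq, lt_div_iff₀ hα, ← abs_of_pos hα, ← abs_mul, abs_of_pos hα, sub_mul,
    inv_mul_cancel_right₀ hα.ne', abs_lt] at hnear
  rw [g, Int.floor_eq_iff]
  push_cast
  constructor <;> linarith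

/-! ### The seven families are transferable -/

theorem isTransferable_familyIF : IsTransferable familyIF := by
  intro α ε hα _ hε _ B hB hBn D hD
  have h : (nearest α '' B).Infinite := Set.Infinite.image ((nearest_injOn hα hε).mono hBn) hB
  exact h.mono (Set.image_subset_iff.2 hD)

theorem isTransferable_familyAP : IsTransferable familyAP := by
  intro α ε hα hε0 hε hε' B hB hBn D hD k
  -- Two extra terms guarantee that terms `0` and `1`, which define the new difference `e`, exist.
  obtain ⟨a, d, h⟩ := hB (k + 2)
  let m : ℕ → ℕ+ := fun i ↦ ⟨a + i * d, Nat.add_pos_left a.pos _⟩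
  have hmB : ∀ i < k + 2, m i ∈ B := by
    intro i hi
    obtain ⟨n, hn, hn'⟩ := h i hi
    have : n = m i := PNat.eq hn'
    rwa [← this]
  have hmn : ∀ i < k + 2, |((m i : ℕ) : ℝ) * α - (nearest α (m i) : ℕ)| < ε :=
    fun i hi ↦ hBn (hmB i hi)
  have hm : ∀ i, ((m i : ℕ) : ℝ) = (a : ℕ) + i * (d : ℕ) := by
    intro i
    simp [m]
  have h0 := hmn 0 (by omega)
  have h1 := hmn 1 (by omega)
  have hd : |((d : ℕ) : ℝ) * α -
      (((nearest α (m 1) : ℕ) - (nearest α (m 0) : ℕ) : ℤ) : ℝ)| < 2 * ε := by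
    rw [hm] at h0 h1
    push_cast at *
    rw [abs_lt] at *
    constructor <;> linarith
  obtain ⟨e, he⟩ := exists_pnat_of_abs_lt hd (by linarith [le_cast_mul hα d])
  rw [he] at hd
  have hind : ∀ i < k + 1, (nearest α (m (i + 1)) : ℕ) = nearest α (m i) + e := by
    intro i hi
    have h2 := hmn i (by omega)
    have h3 := hmn (i + 1) (by omega)
    rw [← PNat.add_coe]
    congr 1
    -- The other error is below `ε + 2 * ε`, and `4 * ε ≤ 1`.
    refine pnat_eq_of_abs_lt h3 ?_
    rw [hm] at *
    push_cast at *
    rw [abs_lt] at *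
    constructor <;> linarith
  have hind' : ∀ i < k + 2, (nearest α (m i) : ℕ) = nearest α (m 0) + i * e := by
    intro i
    induction i with
    | zero => simp
    | succ i ih =>
      intro hi
      rw [hind i (by omega), ih (by omega)]
      ring
  exact ⟨nearest α (m 0), e, fun i hi ↦
    ⟨_, hD _ (hmB i (by omega)), hind' i (by omega)⟩⟩

theorem isTransferable_familyPS : IsTransferable familyPS := by
  rintro α ε hα hε0 - hε' B ⟨G, hG, h⟩ hBn D hD
  obtain ⟨T, hT⟩ := G.exists_le
  obtain ⟨N, hN⟩ := exists_nat_ge (3 / α)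
  obtain ⟨M, hM⟩ := exists_nat_ge ((1 + (T : ℕ)) * α + 3)
  have hN : 3 ≤ N * α := (div_le_iff₀ hα).1 hN
  refine ⟨Finset.Icc 1 M.succPNat, ⟨1, by simp⟩, fun F hF ↦ ?_⟩
  -- `s u * α` is `u` plus a bounded error, so a translate of `s '' F` inside the thick set becomes,
  -- after `nearest α`, a translate of `F` up to bounded gaps. The shift `N` makes the new
  -- translation `z` positive; `M` bounds the gaps.
  let s : ℕ+ → ℕ+ := fun u ↦ (⌈((u : ℕ) : ℝ) / α⌉₊ + N).succPNat
  have hs : ∀ u : ℕ+, (u : ℕ) + (N + 1) * α ≤ (s u : ℕ) * α ∧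
      (s u : ℕ) * α ≤ (u : ℕ) + (N + 2) * α := by
    intro u
    have h1 := Nat.le_ceil (((u : ℕ) : ℝ) / α)
    have h2 := (Nat.ceil_lt_add_one (a := ((u : ℕ) : ℝ) / α) (by positivity)).le
    rw [div_le_iff₀ hα] at h1
    have h2 := mul_le_mul_of_nonneg_right h2 hα.le
    rw [add_mul, div_mul_cancel₀ _ hα.ne'] at h2
    simp only [s, Nat.succPNat_coe]
    push_cast
    constructor <;> linarith
  obtain ⟨x, hx⟩ := h (F.image s) (hF.image s)
  have hy : 3 ≤ (N + 1 + (x : ℕ)) * α := by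
    have : 0 ≤ (x : ℕ) * α := by positivity
    linarith
  have hy1 := Nat.floor_le (by linarith : 0 ≤ (N + 1 + (x : ℕ)) * α)
  have hy2 := Nat.lt_floor_add_one ((N + 1 + (x : ℕ)) * α)
  have hy3 : 3 ≤ ⌊(N + 1 + (x : ℕ)) * α⌋₊ := Nat.le_floor (by exact_mod_cast hy)
  obtain ⟨z, hz⟩ : ∃ z : ℕ+, ⌊(N + 1 + (x : ℕ)) * α⌋₊ = z + 1 :=
    ⟨⟨⌊(N + 1 + (x : ℕ)) * α⌋₊ - 1, by omega⟩, by simp; omega⟩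
  rw [hz] at hy1 hy2
  refine ⟨z, fun u hu ↦ ?_⟩
  obtain ⟨t, ht, htB⟩ := hx (s u) (Finset.mem_image_of_mem s hu)
  have hn : |(((t + (s u + x) : ℕ+) : ℕ) : ℝ) * α - (nearest α (t + (s u + x)) : ℕ)| < ε :=
    hBn htB
  have hnD := hD _ htB
  generalize nearest α (t + (s u + x)) = n at hn hnD
  obtain ⟨h1, h2⟩ := hs u
  have htT : ((t : ℕ) : ℝ) * α ≤ (T : ℕ) * α := by
    have := hT t ht
    gcongr
    exact_mod_cast this
  have ht0 : 0 ≤ (t : ℕ) * α := by positivity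
  push_cast at *
  rw [abs_lt] at hn
  have hlow : ((u : ℕ) : ℝ) + (z : ℕ) < (n : ℕ) := by linarith
  have hupp : ((n : ℕ) : ℝ) ≤ (u : ℕ) + (z : ℕ) + M := by linarith
  have hlow' : (u : ℕ) + z < n := by exact_mod_cast hlow
  have hupp' : (n : ℕ) ≤ u + z + M := by exact_mod_cast hupp
  obtain ⟨v, hv⟩ : ∃ v : ℕ+, (n : ℕ) = v + (u + z) :=
    ⟨⟨n - (u + z), by omega⟩, by rw [PNat.mk_coe]; omega⟩
  refine ⟨v, ?_, ?_⟩
  · rw [Finset.mem_Icc, ← PNat.coe_le_coe v, Nat.succPNat_coe]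
    exact ⟨one_le, by omega⟩
  · have : v + (u + z) = n := PNat.eq (by rw [hv]; push_cast; rfl)
    rwa [this]

/-- `nearest α` is injective on `B` and `nearest α n ≤ (α + 1) * n`, so convergence over `D` would
force it over `B`. -/
theorem isTransferable_familyHSD : IsTransferable familyHSD := by
  intro α ε hα hε0 hε hε' B hB hBn D hD hsum
  apply hB
  let i : B → D := fun n ↦ ⟨nearest α n, hD n n.2⟩
  have hi : Function.Injective i := by
    intro x y hxy
    exact Subtype.ext (nearest_injOn hα hε (hBn x.2) (hBn y.2) (congrArg Subtype.val hxy))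
  refine Summable.of_nonneg_of_le (fun _ ↦ by positivity) (fun n ↦ ?_)
    ((hsum.comp_injective hi).mul_left (α + 1))
  have hn : |(((n : ℕ+) : ℕ) : ℝ) * α - (nearest α n : ℕ)| < ε := hBn n.2
  have h1 := one_le_cast n
  have h2 := one_le_cast (nearest α n)
  rw [abs_lt] at hn
  simp only [Function.comp_apply, i]
  rw [mul_one_div, div_le_div_iff₀ (by linarith) (by linarith)]
  linarith

/-! #### Densities -/

theorem finite_countIoc (A : Set ℕ+) (m n : ℕ) :
    {k : ℕ+ | k ∈ A ∧ m < (k : ℕ) ∧ (k : ℕ) ≤ n}.Finite := by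
  refine (Set.finite_Icc (1 : ℕ+) n.succPNat).subset fun k hk ↦ ⟨one_le, ?_⟩
  rw [← PNat.coe_le_coe, Nat.succPNat_coe]
  exact hk.2.2.trans (Nat.le_succ n)

theorem countIoc_le (A : Set ℕ+) (m n : ℕ) : countIoc A m n ≤ n - m := by
  have h : Set.InjOn (fun k : ℕ+ ↦ (k : ℕ)) {k : ℕ+ | k ∈ A ∧ m < (k : ℕ) ∧ (k : ℕ) ≤ n} :=
    fun x _ y _ hxy ↦ PNat.eq hxy
  rw [countIoc, ← h.ncard_image, ← Nat.card_Ioc, ← Set.ncard_coe_finset]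
  refine Set.ncard_le_ncard ?_ (Finset.finite_toSet _)
  rintro _ ⟨k, hk, rfl⟩
  simpa using hk.2

theorem countIoc_div_le_one (A : Set ℕ+) {m n : ℕ} (h : m ≤ n) :
    (countIoc A m n : ℝ) / ((n : ℝ) - m) ≤ 1 := by
  have h' : (countIoc A m n : ℝ) ≤ (n : ℝ) - m := by
    rw [← Nat.cast_sub h]
    exact_mod_cast countIoc_le A m n
  exact div_le_one_of_le₀ h' ((Nat.cast_nonneg _).trans h')

theorem countIoc_le_countIoc {α ε : ℝ} (hα : 0 < α) (hε : ε ≤ α / 4) (hε' : ε ≤ 1 / 8)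
    {B D : Set ℕ+} (hBn : B ⊆ near α ε) (hD : ∀ n ∈ B, nearest α n ∈ D) (m n : ℕ) :
    countIoc B m n ≤ countIoc D (⌊m * α⌋₊ - 1) (⌊n * α⌋₊ + 1) := by
  rw [countIoc, countIoc]
  refine Set.ncard_le_ncard_of_injOn (nearest α) ?_
    ((nearest_injOn hα hε).mono fun k hk ↦ hBn hk.1) (finite_countIoc _ _ _)
  rintro k ⟨hkB, hmk, hkn⟩
  have hk : |((k : ℕ) : ℝ) * α - (nearest α k : ℕ)| < ε := hBn hkB
  have h1 : (m : ℝ) * α ≤ (k : ℕ) * α := by gcongr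
  have h2 : ((k : ℕ) : ℝ) * α ≤ n * α := by gcongr
  have h3 := Nat.floor_le (by positivity : 0 ≤ (m : ℝ) * α)
  have h4 := Nat.lt_floor_add_one ((n : ℝ) * α)
  rw [abs_lt] at hk
  have h5 : (⌊(m : ℝ) * α⌋₊ : ℝ) < (nearest α k : ℕ) + 1 := by linarith
  have h6 : ((nearest α k : ℕ) : ℝ) < ⌊(n : ℝ) * α⌋₊ + 2 := by linarith
  have h5' : ⌊(m : ℝ) * α⌋₊ < (nearest α k : ℕ) + 1 := by exact_mod_cast h5
  have h6' : (nearest α k : ℕ) < ⌊(n : ℝ) * α⌋₊ + 2 := by exact_mod_cast h6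
  -- Needed when `⌊m * α⌋₊ = 0`: the truncated lower end is then `0`.
  have := (nearest α k).pos
  exact ⟨hD k hkB, by omega, by omega⟩

/-- Ratios of counts are preserved up to a constant factor. -/
theorem exists_le_countIoc_div {α : ℝ} (hα : 0 < α) {c : ℝ} (hc : 0 < c) :
    ∃ c' > 0, ∀ ε, ε ≤ α / 4 → ε ≤ 1 / 8 → ∀ B D : Set ℕ+, B ⊆ near α ε →
      (∀ n ∈ B, nearest α n ∈ D) → ∀ m n : ℕ, m < n →
      c < (countIoc B m n : ℝ) / ((n : ℝ) - m) →
      c' ≤ (countIoc D (⌊m * α⌋₊ - 1) (⌊n * α⌋₊ + 1) : ℝ) /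
        (((⌊n * α⌋₊ + 1 : ℕ) : ℝ) - (⌊m * α⌋₊ - 1 : ℕ)) := by
  -- Rounding adds at most `3` to the length `(n - m) * α`, and `n - m ≥ 1`.
  refine ⟨c / (α + 3), by positivity, ?_⟩
  intro ε hε hε' B D hBn hD m n hmn h
  have hmn' : (1 : ℝ) ≤ n - m := by
    have : ((m + 1 : ℕ) : ℝ) ≤ n := by exact_mod_cast hmn
    push_cast at this
    linarith
  rw [lt_div_iff₀ (by linarith)] at h
  have hcount : (countIoc B m n : ℝ) ≤ countIoc D (⌊m * α⌋₊ - 1) (⌊n * α⌋₊ + 1) := by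
    exact_mod_cast countIoc_le_countIoc hα hε hε' hBn hD m n
  have h1 := Nat.floor_le (by positivity : 0 ≤ (n : ℝ) * α)
  have h2 := Nat.lt_floor_add_one ((m : ℝ) * α)
  have h3 : (⌊(m : ℝ) * α⌋₊ : ℝ) ≤ (⌊m * α⌋₊ - 1 : ℕ) + 1 := by
    exact_mod_cast (by omega : ⌊(m : ℝ) * α⌋₊ ≤ (⌊m * α⌋₊ - 1) + 1)
  have h4 : ⌊(m : ℝ) * α⌋₊ - 1 < ⌊(n : ℝ) * α⌋₊ + 1 := by
    have : ⌊(m : ℝ) * α⌋₊ ≤ ⌊(n : ℝ) * α⌋₊ := by gcongr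
    omega
  have h4' : ((⌊(m : ℝ) * α⌋₊ - 1 : ℕ) : ℝ) < (⌊(n : ℝ) * α⌋₊ + 1 : ℕ) := by exact_mod_cast h4
  have hlen : ((⌊n * α⌋₊ + 1 : ℕ) : ℝ) - (⌊m * α⌋₊ - 1 : ℕ) ≤ (α + 3) * (n - m) := by
    push_cast
    linarith
  rw [div_le_div_iff₀ (by positivity) (by linarith)]
  calc c * (((⌊n * α⌋₊ + 1 : ℕ) : ℝ) - (⌊m * α⌋₊ - 1 : ℕ)) ≤ c * ((α + 3) * (n - m)) := by gcongr
    _ = c * (n - m) * (α + 3) := by ring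
    _ ≤ _ := by gcongr; linarith

theorem isTransferable_familyPUAD : IsTransferable familyPUAD := by
  intro α ε hα _ hε hε' B hB hBn D hD
  obtain ⟨c, hc, hcB⟩ := exists_between (show 0 < upperDensity B from hB)
  obtain ⟨c', hc', h⟩ := exists_le_countIoc_div hα hc
  -- A real `limsup` is meaningful only with these bounds.
  have hbdd : ∀ A : Set ℕ+,
      IsBoundedUnder (· ≤ ·) atTop fun n : ℕ ↦ (countIoc A 0 n : ℝ) / n := by
    refine fun A ↦ isBoundedUnder_of ⟨1, fun n ↦ ?_⟩
    simpa using countIoc_div_le_one A (Nat.zero_le n)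
  have hcob : IsCoboundedUnder (· ≤ ·) atTop fun n : ℕ ↦ (countIoc B 0 n : ℝ) / n :=
    (isBoundedUnder_of ⟨0, fun n ↦ by positivity⟩ :
      IsBoundedUnder (· ≥ ·) atTop _).isCoboundedUnder_le
  have hfreq := frequently_lt_of_lt_limsup hcob hcB
  have htend : Tendsto (fun n : ℕ ↦ ⌊(n : ℝ) * α⌋₊ + 1) atTop atTop :=
    tendsto_atTop_mono (fun n ↦ Nat.le_succ _)
      (tendsto_nat_floor_atTop.comp (tendsto_natCast_atTop_atTop.atTop_mul_const hα))
  refine hc'.trans_le (le_limsup_of_frequently_le (htend.frequently ?_) (hbdd D))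
  refine (hfreq.and_eventually (eventually_gt_atTop 0)).mono fun n hn ↦ ?_
  -- For `m = 0` truncated subtraction keeps the lower end at `0`, so initial segments go to initial
  -- segments.
  have := h ε hε hε' B D hBn hD 0 n hn.2 (by simpa using hn.1)
  simpa using this

theorem isTransferable_familyPUBD : IsTransferable familyPUBD := by
  intro α ε hα _ hε hε' B hB hBn D hD
  obtain ⟨c, hc, hcB⟩ := exists_between (show 0 < upperBanachDensity B from hB)
  obtain ⟨c', hc', h⟩ := exists_le_countIoc_div hα hc
  set l : Filter (ℕ × ℕ) := comap (fun I : ℕ × ℕ ↦ (I.2 : ℝ) - I.1) atTop with hl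
  have hl0 : Tendsto (fun I : ℕ × ℕ ↦ (I.2 : ℝ) - I.1) l atTop := tendsto_comap
  have hlt : ∀ᶠ I : ℕ × ℕ in l, I.1 < I.2 := by
    filter_upwards [hl0.eventually_gt_atTop 0] with I hI
    have : (I.1 : ℝ) < I.2 := by linarith
    exact_mod_cast this
  have : NeBot l := by
    refine comap_neBot fun t ht ↦ ?_
    obtain ⟨a, ha⟩ := mem_atTop_sets.1 ht
    obtain ⟨n, hn⟩ := exists_nat_ge a
    exact ⟨(0, n), ha _ (by simpa using hn)⟩
  have hbdd : ∀ A : Set ℕ+, IsBoundedUnder (· ≤ ·) l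
      fun I : ℕ × ℕ ↦ (countIoc A I.1 I.2 : ℝ) / ((I.2 : ℝ) - I.1) := fun A ↦
    ⟨1, eventually_map.2 (hlt.mono fun I hI ↦ countIoc_div_le_one A hI.le)⟩
  have hcob : IsCoboundedUnder (· ≤ ·) l
      fun I : ℕ × ℕ ↦ (countIoc B I.1 I.2 : ℝ) / ((I.2 : ℝ) - I.1) := by
    refine IsBoundedUnder.isCoboundedUnder_le ⟨0, eventually_map.2 (hlt.mono fun I hI ↦ ?_)⟩
    have : (I.1 : ℝ) ≤ I.2 := by exact_mod_cast hI.le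
    exact div_nonneg (Nat.cast_nonneg _) (by linarith)
  have hfreq := frequently_lt_of_lt_limsup hcob hcB
  -- The new interval is at least `α` times as long as the old one.
  have htend : Tendsto (fun I : ℕ × ℕ ↦ (⌊(I.1 : ℝ) * α⌋₊ - 1, ⌊(I.2 : ℝ) * α⌋₊ + 1)) l l := by
    refine tendsto_comap_iff.2 (tendsto_atTop_mono (fun I ↦ ?_) (hl0.atTop_mul_const hα))
    have h1 := Nat.lt_floor_add_one ((I.2 : ℝ) * α)
    have h2 := Nat.floor_le (by positivity : 0 ≤ (I.1 : ℝ) * α)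
    have h3 : ((⌊(I.1 : ℝ) * α⌋₊ - 1 : ℕ) : ℝ) ≤ ⌊(I.1 : ℝ) * α⌋₊ := by
      exact_mod_cast Nat.sub_le _ _
    simp only [Function.comp_apply]
    push_cast
    linarith
  refine hc'.trans_le (le_limsup_of_frequently_le (htend.frequently ?_) (hbdd D))
  exact (hfreq.and_eventually hlt).mono fun I hI ↦ h ε hε hε' B D hBn hD I.1 I.2 hI.2 hI.1

/-! #### `J`-sets -/

/-- Simultaneously for finitely many real sequences, some late block sum is close to an integer. -/
theorem exists_block_near_int {ι : Type*} [Finite ι] (u : ι → ℕ → ℝ) {δ : ℝ} (hδ : 0 < δ) (N : ℕ) :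
    ∃ a b, N ≤ a ∧ a < b ∧ ∀ i, ∃ z : ℤ, |∑ n ∈ Finset.Ico a b, u i n - z| < δ := by
  have := Fintype.ofFinite ι
  -- Partial sums modulo `1` lie in a compact torus; a convergent subsequence is Cauchy, and
  -- differences of its terms are block sums.
  obtain ⟨c, φ, hφ, hc⟩ := CompactSpace.tendsto_subseq
    (fun k i ↦ ((∑ n ∈ Finset.range k, u i n : ℝ) : UnitAddCircle))
  obtain ⟨M, hM⟩ := Metric.cauchySeq_iff.1 hc.cauchySeq δ hδ
  have hlt : φ (max M N) < φ (max M N + 1) := hφ (Nat.lt_succ_self _)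
  refine ⟨φ (max M N), φ (max M N + 1), (le_max_right M N).trans (hφ.id_le _), hlt, fun i ↦ ?_⟩
  have h := hM (max M N + 1) (by omega) (max M N) (by omega)
  have hi := (dist_le_pi_dist _ _ i).trans_lt h
  rw [Finset.sum_Ico_eq_sub _ hlt.le]
  refine ⟨round (∑ n ∈ Finset.range (φ (max M N + 1)), u i n -
    ∑ n ∈ Finset.range (φ (max M N)), u i n), ?_⟩
  rw [← UnitAddCircle.norm_eq]
  simpa only [Function.comp_apply, dist_eq_norm, ← AddCircle.coe_sub] using hi

/-- Disjoint blocks with block sums close to integers. -/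
theorem exists_blocks_near_int {ι : Type*} [Finite ι] (u : ι → ℕ → ℝ) {δ : ℕ → ℝ}
    (hδ : ∀ n, 0 < δ n) :
    ∃ K : ℕ → Finset ℕ, (∀ n, (K n).Nonempty) ∧ Pairwise (Function.onFun Disjoint K) ∧
      ∀ n i, ∃ z : ℤ, |∑ k ∈ K n, u i k - z| < δ n := by
  choose a b hNa hab hz using fun n ↦ exists_block_near_int u (hδ n)
  -- `s n` is where the preceding block ends; the next block starts no earlier.
  let s : ℕ → ℕ := fun n ↦ Nat.rec 0 (fun n N ↦ b n N) n
  have hs : ∀ n, s (n + 1) = b n (s n) := fun n ↦ rfl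
  have hmono : Monotone s :=
    monotone_nat_of_le_succ fun n ↦ by rw [hs]; exact (hNa _ _).trans (hab _ _).le
  refine ⟨fun n ↦ Finset.Ico (a n (s n)) (b n (s n)), fun n ↦ Finset.nonempty_Ico.2 (hab _ _), ?_,
    fun n i ↦ hz n (s n) i⟩
  refine (pairwise_disjoint_on _).2 fun m n hmn ↦ ?_
  have h1 : b m (s m) ≤ s n := hs m ▸ hmono (Nat.succ_le_of_lt hmn)
  have h2 := hNa n (s n)
  rw [Finset.disjoint_left]
  intro k hk hk'
  rw [Finset.mem_Ico] at hk hk'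
  omega

/-- Blocks common to all `f ∈ F` make the block sums of `f / α` nearly integers `f' f n`. The
`J`-property of `B` for the sequences `f' f` gives `m = a + ∑ f' f n` in `B`. Then `nearest α m`
minus the sum of `f` over the united blocks is an integer within `2 * ε` of `a * α`, hence the same
integer `a'` for every `f`. -/
theorem isTransferable_familyJ : IsTransferable familyJ := by
  classical
  intro α ε hα hε0 hε hε' B hB hBn D hD F hF
  have hδ0 : 0 < ε / α := div_pos hε0 hα
  have hεα : ε / α * α = ε := div_mul_cancel₀ _ hα.ne'
  obtain ⟨K, hKne, hKd, hK⟩ := exists_blocks_near_int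
    (fun (f : F) k ↦ ((f.1 k : ℕ) : ℝ) / α)
    -- Block sums are at least `1 / α`, so the first bound makes the integers positive; the second
    -- keeps the total error within `ε / α` for every `H`.
    (δ := fun n ↦ min (1 / α) (ε / α / 2 / 2 ^ n)) (fun n ↦ by positivity)
  have hK' : ∀ (f : ℕ → ℕ+) (n : ℕ), ∃ z : ℕ+, f ∈ F →
      |∑ k ∈ K n, ((f k : ℕ) : ℝ) / α - (z : ℕ)| < ε / α / 2 / 2 ^ n := by
    intro f n
    by_cases hf : f ∈ F
    · obtain ⟨z, hz⟩ := hK n ⟨f, hf⟩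
      obtain ⟨k, hk⟩ := hKne n
      have hsum : 1 / α ≤ ∑ k ∈ K n, ((f k : ℕ) : ℝ) / α :=
        (div_le_div_of_nonneg_right (one_le_cast (f k)) hα.le).trans
          (Finset.single_le_sum (f := fun k ↦ ((f k : ℕ) : ℝ) / α)
            (fun i _ ↦ by positivity) hk)
      obtain ⟨w, rfl⟩ := exists_pnat_of_abs_lt hz ((min_le_left _ _).trans hsum)
      exact ⟨w, fun _ ↦ by simpa using hz.trans_le (min_le_right _ _)⟩
    · exact ⟨1, fun h ↦ absurd h hf⟩
  choose f' hf' using hK'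
  have hblock : ∀ f ∈ F, ∀ H : Finset ℕ,
      |(∑ n ∈ H, (f' f n : ℕ) : ℕ) * α - (∑ k ∈ H.biUnion K, (f k : ℕ) : ℕ)| ≤ ε := by
    intro f hf H
    have h1 : |∑ n ∈ H, (((f' f n : ℕ) : ℝ) - ∑ k ∈ K n, ((f k : ℕ) : ℝ) / α)| ≤ ε / α := by
      calc _ ≤ ∑ n ∈ H, |((f' f n : ℕ) : ℝ) - ∑ k ∈ K n, ((f k : ℕ) : ℝ) / α| :=
            Finset.abs_sum_le_sum_abs _ _
        _ ≤ ∑ n ∈ H, ε / α / 2 / 2 ^ n := by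
            refine Finset.sum_le_sum fun n _ ↦ ?_
            rw [abs_sub_comm]
            exact (hf' f n hf).le
        _ ≤ ∑' n : ℕ, ε / α / 2 / 2 ^ n :=
            (summable_geometric_two' _).sum_le_tsum _ fun _ _ ↦ by positivity
        _ = ε / α := tsum_geometric_two' _
    have h2 := mul_le_mul_of_nonneg_right h1 hα.le
    rw [hεα, ← abs_of_pos hα, ← abs_mul, abs_of_pos hα, Finset.sum_sub_distrib,
      ← Finset.sum_biUnion (fun i _ j _ hij ↦ hKd hij), sub_mul, ← Finset.sum_div,
      div_mul_cancel₀ _ hα.ne'] at h2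
    push_cast
    exact h2
  obtain ⟨a, H, hH, h⟩ := hB (F.image f') (hF.image f')
  have hnear : ∀ f ∈ F, ∃ m ∈ D, |((a : ℕ) : ℝ) * α -
      (((m : ℕ) : ℝ) - (∑ k ∈ H.biUnion K, (f k : ℕ) : ℕ))| < 2 * ε := by
    intro f hf
    obtain ⟨m, hmB, hm⟩ := h (f' f) (Finset.mem_image_of_mem f' hf)
    refine ⟨nearest α m, hD m hmB, ?_⟩
    have h1 : |((m : ℕ) : ℝ) * α - (nearest α m : ℕ)| < ε := hBn hmB
    have h2 := hblock f hf H
    rw [hm, Nat.cast_add, add_mul] at h1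
    rw [abs_lt] at *
    rw [abs_le] at h2
    constructor <;> linarith
  obtain ⟨f₀, hf₀⟩ := hF
  obtain ⟨m₀, -, hm₀⟩ := hnear f₀ hf₀
  obtain ⟨a', ha'⟩ := exists_pnat_of_abs_lt
    (a := (m₀ : ℕ) - (∑ k ∈ H.biUnion K, (f₀ k : ℕ) : ℕ)) (by push_cast at *; exact hm₀)
    (by linarith [le_cast_mul hα a])
  refine ⟨a', H.biUnion K, ?_, fun f hf ↦ ?_⟩
  · obtain ⟨n, hn⟩ := hH
    obtain ⟨k, hk⟩ := hKne n
    exact ⟨k, Finset.mem_biUnion.2 ⟨n, hn, hk⟩⟩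
  · obtain ⟨m, hmD, hm⟩ := hnear f hf
    refine ⟨m, hmD, ?_⟩
    have h1 : ((m₀ : ℕ) : ℤ) - (∑ k ∈ H.biUnion K, (f₀ k : ℕ) : ℕ) =
        (m : ℕ) - (∑ k ∈ H.biUnion K, (f k : ℕ) : ℕ) :=
      int_eq_of_abs_lt (x := (a : ℕ) * α) (ε := 2 * ε) (by push_cast at *; exact hm₀)
        (by push_cast at *; exact hm.trans_le (by linarith))
    omega

theorem isTransferable_of_mem {F : Set (Set ℕ+)}
    (hF : F ∈ ({familyIF, familyAP, familyPS, familyHSD, familyJ, familyPUAD, familyPUBD} :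
      Set (Set (Set ℕ+)))) : IsTransferable F := by
  simp only [Set.mem_insert_iff, Set.mem_singleton_iff] at hF
  rcases hF with rfl | rfl | rfl | rfl | rfl | rfl | rfl
  exacts [isTransferable_familyIF, isTransferable_familyAP, isTransferable_familyPS,
    isTransferable_familyHSD, isTransferable_familyJ, isTransferable_familyPUAD,
    isTransferable_familyPUBD]

/-! ### The closure of the smallest ideal -/

section SmallestIdeal

attribute [local instance] Ultrafilter.add Ultrafilter.addSemigroup

theorem isLeftIdeal_range_add (p : Ultrafilter ℕ+) : IsLeftIdeal (Set.range (· + p)) := by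
  refine ⟨Set.range_nonempty _, ?_⟩
  rintro q _ ⟨r, rfl⟩
  exact ⟨q + r, add_assoc q r p⟩

theorem isClosed_range_add (p : Ultrafilter ℕ+) : IsClosed (Set.range (· + p)) :=
  (isCompact_range (Ultrafilter.continuous_add_left p)).isClosed

theorem IsMinimalLeftIdeal.eq_range {L : Set (Ultrafilter ℕ+)} (hL : IsMinimalLeftIdeal L)
    {p : Ultrafilter ℕ+} (hp : p ∈ L) : Set.range (· + p) = L :=
  hL.2 _ (isLeftIdeal_range_add p) (Set.range_subset_iff.2 fun q ↦ hL.1.2 q p hp)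

/-- Every left ideal contains a minimal left ideal. -/
theorem IsLeftIdeal.exists_isMinimalLeftIdeal {I : Set (Ultrafilter ℕ+)} (hI : IsLeftIdeal I) :
    ∃ L ⊆ I, IsMinimalLeftIdeal L := by
  obtain ⟨p, hp⟩ := hI.1
  -- Closedness lets compactness keep intersections of chains nonempty. Minimality then extends to
  -- all left ideals, since each contains a closed one, `Set.range (· + q)`.
  obtain ⟨L, hLp, hL⟩ := zorn_superset_nonempty {J | IsLeftIdeal J ∧ IsClosed J}
    (fun c hc hchain hne ↦ by
      have hclosed : IsClosed (⋂₀ c) := isClosed_sInter fun J hJ ↦ (hc hJ).2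
      have : Nonempty c := hne.to_subtype
      refine ⟨⋂₀ c, ⟨⟨?_, fun q p hp J hJ ↦ (hc hJ).1.2 q p (hp J hJ)⟩, hclosed⟩,
        fun J hJ ↦ Set.sInter_subset_of_mem hJ⟩
      rw [Set.sInter_eq_iInter]
      exact IsCompact.nonempty_iInter_of_directed_nonempty_isCompact_isClosed _
        (fun J K ↦ (hchain.total J.2 K.2).elim (fun h ↦ ⟨J, subset_rfl, h⟩)
          fun h ↦ ⟨K, h, subset_rfl⟩) (fun J ↦ (hc J.2).1.1) (fun J ↦ (hc J.2).2.isCompact)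
        fun J ↦ (hc J.2).2)
    _ ⟨isLeftIdeal_range_add p, isClosed_range_add p⟩
  refine ⟨L, hLp.trans (Set.range_subset_iff.2 fun q ↦ hI.2 q p hp), hL.1.1, fun J hJ hJL ↦ ?_⟩
  obtain ⟨q, hq⟩ := hJ.1
  have hqJ : Set.range (· + q) ⊆ J := Set.range_subset_iff.2 fun r ↦ hJ.2 r q hq
  exact hJL.antisymm
    ((hL.2 ⟨isLeftIdeal_range_add q, isClosed_range_add q⟩ (hqJ.trans hJL)).trans hqJ)

theorem mem_pure_add_iff {t : ℕ+} {q : Ultrafilter ℕ+} {A : Set ℕ+} :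
    A ∈ (pure t : Ultrafilter ℕ+) + q ↔ {s | t + s ∈ A} ∈ q := by
  rw [mem_add_iff, Ultrafilter.mem_pure, Set.mem_ofPred_eq]

/-- Every `q ∈ L` satisfies `p ∈ Set.range (· + q)`, so some `-t + A` is in `q`. Compactness of `L`
leaves finitely many `t`; applying this to each `pure s + p ∈ L` and intersecting over `s ∈ F` gives
`x`. -/
theorem mem_familyPS_of_mem_smallestIdeal {p : Ultrafilter ℕ+} (hp : p ∈ smallestIdeal)
    {A : Set ℕ+} (hA : A ∈ p) : A ∈ familyPS := by
  obtain ⟨L, hL, hpL⟩ := hp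
  have hL : IsMinimalLeftIdeal L := hL
  have hcomp : IsCompact L := by
    rw [← hL.eq_range hpL]
    exact (isClosed_range_add p).isCompact
  obtain ⟨G, hG⟩ := hcomp.elim_finite_subcover (fun t : ℕ+ ↦ {q | {s | t + s ∈ A} ∈ q})
    (fun t ↦ ultrafilter_isOpen_basic _) (fun q hq ↦ by
      rw [← hL.eq_range hq] at hpL
      obtain ⟨r, rfl⟩ := hpL
      obtain ⟨t, ht⟩ := r.nonempty_of_mem (mem_add_iff.1 hA)
      exact Set.mem_iUnion.2 ⟨t, ht⟩)
  have hcover : ∀ q ∈ L, {s | ∃ t ∈ G, t + s ∈ A} ∈ q := by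
    intro q hq
    obtain ⟨t, ht, htq⟩ := Set.mem_iUnion₂.1 (hG hq)
    exact mem_of_superset htq fun s hs ↦ ⟨t, ht, hs⟩
  refine ⟨G, ?_, fun F _ ↦ ?_⟩
  · obtain ⟨s, t, ht, -⟩ := p.nonempty_of_mem (hcover p hpL)
    exact ⟨t, ht⟩
  · have h : ∀ s ∈ F, {x | ∃ t ∈ G, t + (s + x) ∈ A} ∈ (p : Filter ℕ+) := fun s _ ↦
      mem_pure_add_iff.1 (hcover _ (hL.1.2 (pure s) p hpL))
    obtain ⟨x, hx⟩ := p.nonempty_of_mem ((biInter_finset_mem F).2 h)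
    exact ⟨x, fun s hs ↦ Set.mem_iInter₂.1 hx s hs⟩

/-- The translates of `T` have the finite intersection property. An ultrafilter `p` containing them
all puts `T` into every `r + p`, in particular into a point of a minimal left ideal; adding a
suitable `t ∈ G` on the left turns `T` into `A`. -/
theorem exists_mem_smallestIdeal {A : Set ℕ+} (hA : A ∈ familyPS) :
    ∃ p ∈ smallestIdeal, A ∈ p := by
  obtain ⟨G, hG, h⟩ := hA
  let T : Set ℕ+ := ⋃ t ∈ G, {s | t + s ∈ A}
  have hT : ∀ n, n ∈ T ↔ ∃ t ∈ G, t + n ∈ A := fun n ↦ by simp [T]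
  have hneBot : NeBot (⨅ s : ℕ+, 𝓟 {x | s + x ∈ T}) := by
    classical
    refine (hasBasis_iInf_principal_finite _).neBot_iff.2 ?_
    intro S hS
    -- `S` may be empty; inserting `1` makes the finite set nonempty.
    obtain ⟨x, hx⟩ := h (insert 1 hS.toFinset) (Finset.insert_nonempty _ _)
    refine ⟨x, Set.mem_iInter₂.2 fun s hs ↦ (hT _).2 (hx s ?_)⟩
    exact Finset.mem_insert_of_mem (hS.mem_toFinset.2 hs)
  obtain ⟨p, hp⟩ := Ultrafilter.exists_le (⨅ s : ℕ+, 𝓟 {x | s + x ∈ T})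
  have hpT : ∀ s : ℕ+, {x | s + x ∈ T} ∈ p := fun s ↦
    hp (mem_iInf_of_mem s (mem_principal_self _))
  obtain ⟨L, hLp, hL⟩ := (isLeftIdeal_range_add p).exists_isMinimalLeftIdeal
  obtain ⟨q, hq⟩ := hL.1.1
  obtain ⟨r, rfl⟩ := hLp hq
  have hTr : T ∈ r + p := mem_add_iff.2 (univ_mem' hpT)
  obtain ⟨t, ht, htq⟩ := (Ultrafilter.finite_biUnion_mem_iff G.finite_toSet).1 hTr
  exact ⟨_, ⟨L, hL, hL.1.2 (pure t) _ hq⟩, mem_pure_add_iff.2 htq⟩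

theorem closure_smallestIdeal : closure smallestIdeal = beta familyPS := by
  ext p
  rw [ultrafilterBasis_is_basis.mem_closure_iff]
  constructor
  · intro h A hA
    obtain ⟨q, hqA, hq⟩ := h _ ⟨A, rfl⟩ hA
    exact mem_familyPS_of_mem_smallestIdeal hq hqA
  · rintro h _ ⟨A, rfl⟩ hA
    obtain ⟨q, hq, hqA⟩ := exists_mem_smallestIdeal (h A hA)
    exact ⟨q, hqA, hq⟩

end SmallestIdeal

/-! ### The classical notions as essential sets -/

/-- Every idempotent lies in `beta familyIF`, so this is Hindman's theorem and its converse. -/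
theorem isIPSet_eq : IsIPSet = IsEssential familyIF := by
  ext A
  constructor
  · rintro ⟨x, hx⟩
    obtain ⟨p, hp, hpx⟩ := Hindman.exists_idempotent_ultrafilter_le_FS x
    have hp : IsIdem p := hp
    exact ⟨p, fun B hB ↦ hp.infinite hB, hp, mem_of_superset hpx hx⟩
  · rintro ⟨p, -, hp, hA⟩
    exact Hindman.exists_FS_of_large p hp A hA

theorem isCSet_eq : IsCSet = IsEssential familyJ := by
  ext A
  exact ⟨fun ⟨p, hp, hF, hA⟩ ↦ ⟨p, hF, hp, hA⟩, fun ⟨p, hF, hp, hA⟩ ↦ ⟨p, hp, hF, hA⟩⟩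

theorem isDSet_eq : IsDSet = IsEssential familyPUBD := by
  ext A
  exact ⟨fun ⟨p, hp, hF, hA⟩ ↦ ⟨p, hF, hp, hA⟩, fun ⟨p, hF, hp, hA⟩ ↦ ⟨p, hp, hF, hA⟩⟩

theorem isQuasiCentral_eq : IsQuasiCentral = IsEssential familyPS := by
  ext A
  rw [IsQuasiCentral, closure_smallestIdeal, IsEssential]

end EssentialSpectra

theorem mainTheorem10 (α γ : ℝ) (hα : 0 < α) (hγ₀ : 0 < γ) (hγ₁ : γ < 1) :
    (∀ F ∈ ({EssentialSpectra.familyIF, EssentialSpectra.familyAP, EssentialSpectra.familyPS,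
          EssentialSpectra.familyHSD, EssentialSpectra.familyJ, EssentialSpectra.familyPUAD,
          EssentialSpectra.familyPUBD} : Set (Set (Set ℕ+))),
        (∀ A : Set ℕ+, EssentialSpectra.IsEssential F A →
          EssentialSpectra.IsEssential F (EssentialSpectra.gImage α γ A)) ∧
        (∀ A : Set ℕ+, EssentialSpectra.IsStar (EssentialSpectra.IsEssential F) A →
          EssentialSpectra.IsStar (EssentialSpectra.IsEssential F)
            (EssentialSpectra.gImage α γ A))) ∧
    (∀ P ∈ ({EssentialSpectra.IsIPSet, EssentialSpectra.IsCSet, EssentialSpectra.IsDSet,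
          EssentialSpectra.IsQuasiCentral} : Set (Set ℕ+ → Prop)),
        (∀ A : Set ℕ+, P A → P (EssentialSpectra.gImage α γ A)) ∧
        (∀ A : Set ℕ+, EssentialSpectra.IsStar P A →
          EssentialSpectra.IsStar P (EssentialSpectra.gImage α γ A))) := by
  have key := fun F hF ↦
    have h := EssentialSpectra.isTransferable_of_mem (F := F) hF
    And.intro (fun A ↦ h.isEssential_gImage (A := A) hα hγ₀ hγ₁)
      (fun A ↦ h.isStar_gImage (A := A) hα hγ₀ hγ₁)
  refine ⟨key, fun P hP ↦ ?_⟩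
  simp only [Set.mem_insert_iff, Set.mem_singleton_iff] at hP
  rcases hP with rfl | rfl | rfl | rfl
  · rw [EssentialSpectra.isIPSet_eq]
    exact key _ (by simp)
  · rw [EssentialSpectra.isCSet_eq]
    exact key _ (by simp)
  · rw [EssentialSpectra.isDSet_eq]
    exact key _ (by simp)
  · rw [EssentialSpectra.isQuasiCentral_eq]
    exact key _ (by simp)
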